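/- A \emph{BP instance with cardinality constraint} on a finite ground set $V$ consists of two set functions $f,g:2^V\to\mathbb{R}$ that are normalized ($f(\emptyset)=g(\emptyset)=0$) and monotone non-decreasing, with $f$ submodular and $g$ supermodular, and of an integer $k\ge 0$; the problem is to maximize $h(X)=f(X)+g(X)$ over all $X\subseteq V$ with $|X|\le k$, and $\mathrm{OPT}$ denotes the maximum. When $V \neq \emptyset$ and $g(V)-g(V\setminus\{v\})>0$ for all $v\in V$, the supermodular curvature of $g$ is $$\kappa^g = 1-\min_{v\in V}\frac{g(\{v\})}{g(V)-g(V\setminus\{v\})}.$$ A (randomized) value-oracle algorithm is given $V=\{1,\dots,n\}$ and $k$, adaptively queries sets $X\subseteq V$, receives the values $f(X)$ and $g(X)$, and finally outputs a subset of $V$; computation between queries is unrestricted. It makes polynomially many queries if, for some polynomial $p$, it makes at most $p(n)$ queries on every BP instance on $n$ elements, whatever its random choices. On an instance, its output $\hat X$ achieves the factor $\rho$ if $|\hat X|\le k$ and $h(\hat X)\ge \rho\cdot\mathrm{OPT}$. \textbf{Theorem (hardness for the cardinality constrained case).} For every $\beta\in[0,1]$ there is a sequence $(D_n)_{n}$ of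 probability distributions, where $D_n$ is a distribution of instances on the ground set $\{1,\dots,n\}$ and, for all sufficiently large $n$, every instance in the support of $D_n$ is a BP instance with $g(V)-g(V\setminus\{v\})>0$ for all $v \in V$ and with $\kappa^g=\beta$, such that the following holds. For every randomized value-oracle algorithm that makes polynomially many queries and for every $\varepsilon>0$, the probability (over the instance drawn from $D_n$ and the independent randomness of the algorithm) that the output achieves the factor $1-\kappa^g+\varepsilon = 1-\beta+\varepsilon$ is $n^{-\omega(1)}$, that is, it decays faster than every inverse polynomial in $n$. In particular, no algorithm making polynomially many value-oracle queries achieves, on all BP instances with $\kappa^g=\beta$ under a cardinality constraint, an approximation factor of $1-\kappa^g+\varepsilon$, for any $\varepsilon>0$. -/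

import Mathlib

namespace BPMax

/-- `f(X) + f(Y) ≥ f(X ∪ Y) + f(X ∩ Y)` for all `X, Y ⊆ V`. -/
def Submodular {V : Type*} [DecidableEq V] (f : Finset V → ℝ) : Prop :=
  ∀ X Y : Finset V, f (X ∪ Y) + f (X ∩ Y) ≤ f X + f Y

/-- `g` is supermodular if `-g` is submodular. -/
def Supermodular {V : Type*} [DecidableEq V] (g : Finset V → ℝ) : Prop :=
  Submodular fun X => -g X

/-- The gain `g(v | X) = g({v} ∪ X) - g(X)`. -/
def gain {V : Type*} [DecidableEq V] (g : Finset V → ℝ) (v : V) (X : Finset V) : ℝ :=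
  g (insert v X) - g X

/-- The supermodular curvature `κ^g = 1 - min_{v ∈ V} g(v) / g(v | V \ {v})`. It is used only for
functions all of whose gains `g(v | V \ {v})` are positive, on a nonempty ground set. -/
noncomputable def supermodularCurvature {V : Type*} [Fintype V] [DecidableEq V]
    (g : Finset V → ℝ) : ℝ :=
  1 - ⨅ v : V, g {v} / gain g v (Finset.univ.erase v)

/-- Data of a maximization problem `max {f(X) + g(X) : |X| ≤ k}` over a ground set `V`. -/
structure CardInstance (V : Type*) where
  f : Finset V → ℝ
  g : Finset V → ℝ
  k : ℕ

namespace CardInstance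

variable {V : Type*}

/-- The objective `h = f + g`. -/
def h (I : CardInstance V) (X : Finset V) : ℝ := I.f X + I.g X

/-- `f` and `g` are normalized and monotone non-decreasing, `f` is submodular and `g` is
supermodular. -/
structure IsBP [DecidableEq V] (I : CardInstance V) : Prop where
  f_empty : I.f ∅ = 0
  g_empty : I.g ∅ = 0
  f_mono : Monotone I.f
  g_mono : Monotone I.g
  f_submodular : Submodular I.f
  g_supermodular : Supermodular I.g

/-- The value oracle: a query `X` is answered by both `f(X)` and `g(X)`. -/
def oracle (I : CardInstance V) (X : Finset V) : ℝ × ℝ := (I.f X, I.g X)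

/-- The optimal value `max {h(X) : |X| ≤ k}`. -/
noncomputable def opt [Fintype V] (I : CardInstance V) : ℝ :=
  (Finset.univ.filter fun X : Finset V => X.card ≤ I.k).sup' ⟨∅, by simp⟩ I.h

/-- `X` is feasible and its value is at least `ρ` times the optimal value. -/
def IsApprox [Fintype V] (I : CardInstance V) (ρ : ℝ) (X : Finset V) : Prop :=
  X.card ≤ I.k ∧ ρ * I.opt ≤ I.h X

end CardInstance

/-- A deterministic adaptive value-oracle algorithm: it either stops with an output set, or queries
a set and continues in a way that depends on the answer. Computation between queries is free. -/
inductive QueryAlg (V : Type*) where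
  | output (S : Finset V) : QueryAlg V
  | query (X : Finset V) (next : ℝ × ℝ → QueryAlg V) : QueryAlg V

namespace QueryAlg

variable {V : Type*}

/-- The set returned when the queries are answered by `O`. -/
def run (O : Finset V → ℝ × ℝ) : QueryAlg V → Finset V
  | output S => S
  | query X next => run O (next (O X))

/-- The number of queries made when they are answered by `O`. -/
def numQueries (O : Finset V → ℝ × ℝ) : QueryAlg V → ℕ
  | output _ => 0
  | query X next => numQueries O (next (O X)) + 1

end QueryAlg

/-- A randomized algorithm: for every size `n` of the ground set and every cardinality bound `k`,
a probability distribution on deterministic query algorithms. -/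
abbrev RandAlg : Type := (n : ℕ) → ℕ → PMF (QueryAlg (Fin n))

/-- For some polynomial `p`, the algorithm makes, on every BP instance whose ground set has `n`
elements and for every outcome of its randomness, at most `p(n)` queries. -/
def RandAlg.PolyQueries (A : RandAlg) : Prop :=
  ∃ p : Polynomial ℕ, ∀ (n : ℕ) (I : CardInstance (Fin n)), I.IsBP →
    ∀ T ∈ (A n I.k).support, T.numQueries I.oracle ≤ p.eval n

/-- The probability that `A` outputs a `ρ`-approximate solution of the instance `I`. -/
noncomputable def RandAlg.successProb (A : RandAlg) (ρ : ℝ) {n : ℕ} (I : CardInstance (Fin n)) :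
    ENNReal :=
  (A n I.k).toOuterMeasure {T | I.IsApprox ρ (T.run I.oracle)}

/-- The probability that `A` outputs a `ρ`-approximate solution of an instance that is drawn from
the distribution `D`, independently of the randomness of `A`. -/
noncomputable def RandAlg.avgSuccessProb (A : RandAlg) (ρ : ℝ) {n : ℕ}
    (D : PMF (CardInstance (Fin n))) : ENNReal :=
  ∑' I, D I * A.successProb ρ I

end BPMax

/-! Hide a uniformly random `a`-set `R` inside a matroid rank: `|X|` minus `β` times the rank is
supermodular of curvature `β`, and `R` has rank only `b`, much smaller than `a`. Thus `R` has value
about `a`, while any feasible set meeting `R` in at most `b` elements has value at most `1 + (1 - β)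
a`. A query distinguishes `R` from the uninformative case `∅` only if it has at most `2a` elements
and more than `b` of them lie in `R`. With `a = m²`, `b = m` and `m ≈ n^(1/8)`, a fixed set does so
with probability at most `(4a²/n)^(m+1)`, which is superpolynomially small. A union bound over the
queries asked along the `∅` run and its output (`QueryAlg.card_filter_run_le`) finishes, since
averaging over deterministic algorithms covers randomness. -/

namespace BPMax

open Finset

/-! ### The hidden-set instances -/

section HiddenRank

variable {V : Type*} [DecidableEq V]

/-- The rank function `min {|X|, a, b + |X \ R|}` of a matroid of rank at most `a`, in which the set
`R` has rank at most `b`. -/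
def hiddenRank (R : Finset V) (a b : ℕ) (X : Finset V) : ℕ :=
  min (min X.card a) (b + (X \ R).card)

/-- The rank grows by at most one per element, so subtracting `β ≤ 1` times it keeps `g` monotone.
-/
theorem hiddenRank_add_card_le (R : Finset V) (a b : ℕ) {X Y : Finset V} (h : X ⊆ Y) :
    hiddenRank R a b Y + X.card ≤ hiddenRank R a b X + Y.card := by
  have h₁ := card_le_card h
  have h₂ := card_le_card (sdiff_subset_sdiff h (Subset.refl R))
  have h₃ := card_le_card (inter_subset_inter_right h (u := R))
  have h₄ := card_sdiff_add_card_inter X R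
  have h₅ := card_sdiff_add_card_inter Y R
  simp only [hiddenRank]
  omega

theorem hiddenRank_union_add_inter_le (R : Finset V) (a b : ℕ) (X Y : Finset V) :
    hiddenRank R a b (X ∪ Y) + hiddenRank R a b (X ∩ Y) ≤
      hiddenRank R a b X + hiddenRank R a b Y := by
  have key : ∀ Z W : Finset V, Z ⊆ W → Z.card ≤ W.card ∧ (Z \ R).card ≤ (W \ R).card ∧
      (Z ∩ R).card ≤ (W ∩ R).card := fun Z W h =>
    ⟨card_le_card h, card_le_card (sdiff_subset_sdiff h (Subset.refl R)),
      card_le_card (inter_subset_inter_right h)⟩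
  have h₁ := key _ _ (inter_subset_left (s₁ := X) (s₂ := Y))
  have h₂ := key _ _ (inter_subset_right (s₁ := X) (s₂ := Y))
  have h₃ := card_union_add_card_inter X Y
  have h₄ := card_union_add_card_inter (X \ R) (Y \ R)
  have e : X \ R ∩ (Y \ R) = (X ∩ Y) \ R := by
    ext x
    simp only [mem_inter, mem_sdiff]
    tauto
  rw [← union_sdiff_distrib, e] at h₄
  have h₅ := card_sdiff_add_card_inter X R
  have h₆ := card_sdiff_add_card_inter Y R
  have h₇ := card_sdiff_add_card_inter (X ∪ Y) R
  have h₈ := card_sdiff_add_card_inter (X ∩ Y) R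
  simp only [hiddenRank]
  omega

/-- The instance with `f(X) = min {|X|, 1}`, `g(X) = |X| - β min {|X|, a, b + |X \ R|}` and `k = a`.
For `R = ∅` this is the instance that contains no information on a hidden set. -/
noncomputable def hiddenInstance (β : ℝ) (a b : ℕ) (R : Finset V) : CardInstance V where
  f X := (min X.card 1 : ℕ)
  g X := X.card - β * hiddenRank R a b X
  k := a

theorem hiddenInstance_isBP {β : ℝ} (hβ₀ : 0 ≤ β) (hβ₁ : β ≤ 1) (a b : ℕ) (R : Finset V) :
    (hiddenInstance β a b R).IsBP where
  f_empty := by simp [hiddenInstance]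
  g_empty := by simp [hiddenInstance, hiddenRank]
  f_mono := by
    intro X Y h
    have := card_le_card h
    simp only [hiddenInstance, Nat.cast_le]
    omega
  g_mono := by
    intro X Y h
    have h₁ : (hiddenRank R a b Y : ℝ) + X.card ≤ hiddenRank R a b X + Y.card := by
      exact_mod_cast hiddenRank_add_card_le R a b h
    have h₂ : (X.card : ℝ) ≤ Y.card := by exact_mod_cast card_le_card h
    simp only [hiddenInstance]
    nlinarith
  f_submodular := by
    intro X Y
    have h := hiddenRank_union_add_inter_le ∅ 1 1 X Y
    have h' : ∀ Z : Finset V, hiddenRank ∅ 1 1 Z = min Z.card 1 := fun Z => by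
      simp only [hiddenRank, sdiff_empty]
      omega
    simp only [h'] at h
    simp only [hiddenInstance]
    exact_mod_cast h
  g_supermodular := by
    intro X Y
    have h₁ : (hiddenRank R a b (X ∪ Y) : ℝ) + hiddenRank R a b (X ∩ Y) ≤
        hiddenRank R a b X + hiddenRank R a b Y := by
      exact_mod_cast hiddenRank_union_add_inter_le R a b X Y
    have h₂ : ((X ∪ Y).card : ℝ) + (X ∩ Y).card = X.card + Y.card := by
      exact_mod_cast card_union_add_card_inter X Y
    simp only [hiddenInstance]
    nlinarith

/-- Deleting `v` keeps the full rank `a`: at least `a - 1` elements remain outside `R`, and `b ≥ 1`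
supplies the missing one. -/
theorem gain_hiddenInstance_univ_erase [Fintype V] (β : ℝ) {a b : ℕ} {R : Finset V}
    (hR : R.card = a) (hb : 1 ≤ b) (ha : 2 * a ≤ Fintype.card V) (ha₁ : a + 1 ≤ Fintype.card V)
    (v : V) : gain (hiddenInstance β a b R).g v (univ.erase v) = 1 := by
  have h₁ : (univ.erase v).card + 1 = Fintype.card V := card_erase_add_one (mem_univ v)
  have h₂ := le_card_sdiff R (univ.erase v)
  have h₃ := le_card_sdiff R (univ : Finset V)
  have h₄ : (univ : Finset V).card = Fintype.card V := rfl
  have e₁ : hiddenRank R a b (univ.erase v) = a := by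
    simp only [hiddenRank]
    omega
  have e₂ : hiddenRank R a b univ = a := by
    simp only [hiddenRank]
    omega
  have h₅ : ((univ.erase v).card : ℝ) + 1 = (univ : Finset V).card := by exact_mod_cast h₁
  rw [gain, insert_erase (mem_univ v)]
  simp only [hiddenInstance, e₁, e₂]
  linarith

theorem hiddenInstance_g_singleton (β : ℝ) {a b : ℕ} (R : Finset V) (ha : 1 ≤ a) (hb : 1 ≤ b)
    (v : V) : (hiddenInstance β a b R).g {v} = 1 - β := by
  have e : hiddenRank R a b {v} = 1 := by
    simp only [hiddenRank, card_singleton]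
    omega
  simp [hiddenInstance, e]

theorem supermodularCurvature_hiddenInstance [Fintype V] [Nonempty V] (β : ℝ) {a b : ℕ}
    {R : Finset V} (hR : R.card = a) (ha₀ : 1 ≤ a) (hb : 1 ≤ b) (ha : 2 * a ≤ Fintype.card V)
    (ha₁ : a + 1 ≤ Fintype.card V) :
    supermodularCurvature (hiddenInstance β a b R).g = β := by
  simp only [supermodularCurvature, gain_hiddenInstance_univ_erase β hR hb ha ha₁,
    hiddenInstance_g_singleton β R ha₀ hb, ciInf_const]
  ring

/-- If `|X ∩ R| ≤ b`, then `b + |X \ R| ≥ |X|`; if `|X| > 2a`, then `|X \ R| ≥ a`. Either way the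
term involving `R` does not bind. -/
theorem of_oracle_hiddenInstance_ne {β : ℝ} {a b : ℕ} {R X : Finset V} (hR : R.card = a)
    (h : (hiddenInstance β a b R).oracle X ≠ (hiddenInstance β a b ∅).oracle X) :
    X.card ≤ 2 * a ∧ b + 1 ≤ (X ∩ R).card := by
  have h₁ := card_sdiff_add_card_inter X R
  have h₂ := card_le_card (inter_subset_right (s₁ := X) (s₂ := R))
  by_contra hc
  refine h ?_
  have e : hiddenRank R a b X = hiddenRank ∅ a b X := by
    simp only [hiddenRank, sdiff_empty]
    omega
  simp [CardInstance.oracle, hiddenInstance, e]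

theorem le_opt_hiddenInstance [Fintype V] {β : ℝ} (hβ₀ : 0 ≤ β) {a b : ℕ} {R : Finset V}
    (hR : R.card = a) (ha : 1 ≤ a) : 1 + a - β * b ≤ (hiddenInstance β a b R).opt := by
  have h₁ : (hiddenInstance β a b R).h R ≤ (hiddenInstance β a b R).opt :=
    le_sup' _ (by simp [hiddenInstance, hR])
  have h₂ : (hiddenRank R a b R : ℝ) ≤ b := by
    have : hiddenRank R a b R ≤ b := by simp [hiddenRank]
    exact_mod_cast this
  refine le_trans ?_ h₁
  simp only [CardInstance.h, hiddenInstance, hR, min_eq_right ha]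
  push_cast
  nlinarith

/-- The conclusion matches that of `of_oracle_hiddenInstance_ne`, so one count serves both queries
and outputs. The gain `ε (a - b)` pays for the loss of at most `b` in the optimum and for the `1`
contributed by `f`. -/
theorem of_isApprox_hiddenInstance [Fintype V] {β ε : ℝ} (hβ₀ : 0 ≤ β) (hβ₁ : β ≤ 1) (hε : 0 < ε)
    {a b : ℕ} {R X : Finset V} (hR : R.card = a) (ha : 1 ≤ a)
    (hab : (b : ℝ) + 1 < ε * ((a : ℝ) - b))
    (h : (hiddenInstance β a b R).IsApprox (1 - β + ε) X) :
    X.card ≤ 2 * a ∧ b + 1 ≤ (X ∩ R).card := by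
  obtain ⟨hX, h⟩ := h
  have hX : X.card ≤ a := hX
  refine ⟨by omega, ?_⟩
  by_contra hc
  have h₁ := card_sdiff_add_card_inter X R
  have e : hiddenRank R a b X = X.card := by
    simp only [hiddenRank]
    omega
  have h₂ : (hiddenInstance β a b R).h X ≤ 1 + (1 - β) * a := by
    have h₃ : ((min X.card 1 : ℕ) : ℝ) ≤ 1 := by
      exact_mod_cast min_le_right _ _
    have h₄ : (X.card : ℝ) ≤ a := by exact_mod_cast hX
    simp only [CardInstance.h, hiddenInstance, e]
    nlinarith
  have h₃ := mul_le_mul_of_nonneg_left (le_opt_hiddenInstance hβ₀ hR ha (b := b))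
    (show 0 ≤ 1 - β + ε by linarith)
  have h₄ : (0 : ℝ) ≤ b := Nat.cast_nonneg b
  have h₅ : (1 - β) * (β * b) ≤ b := by
    have h₆ : (1 - β) * β ≤ 1 := by nlinarith
    nlinarith
  have h₆ : ε * (β * b) ≤ ε * b :=
    mul_le_mul_of_nonneg_left (by nlinarith) hε.le
  nlinarith

end HiddenRank

/-! ### Counting sets with a large intersection -/

section Counting

variable {V : Type*} [DecidableEq V] [Fintype V]

theorem card_powersetCard_filter_superset_le (S : Finset V) (a : ℕ) :
    ((powersetCard a (univ : Finset V)).filter fun R => S ⊆ R).card ≤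
      (Fintype.card V - S.card).choose (a - S.card) := by
  rw [← card_compl S, ← card_powersetCard]
  refine card_le_card_of_injOn (fun R => R \ S) ?_ ?_
  · intro R hR
    rw [mem_coe, mem_filter, mem_powersetCard] at hR
    rw [mem_coe, mem_powersetCard]
    refine ⟨fun x hx => by simpa using (mem_sdiff.1 hx).2, ?_⟩
    rw [card_sdiff_of_subset hR.2, hR.1.2]
  · intro R hR R' hR' h
    rw [mem_coe, mem_filter] at hR hR'
    rw [← sdiff_union_of_subset hR.2, ← sdiff_union_of_subset hR'.2]
    exact congrArg (· ∪ S) h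

theorem card_powersetCard_filter_le_card_inter_le (a s : ℕ) (X : Finset V) :
    ((powersetCard a (univ : Finset V)).filter fun R => s ≤ (X ∩ R).card).card ≤
      X.card.choose s * (Fintype.card V - s).choose (a - s) := by
  calc _ ≤ ((powersetCard s X).biUnion fun S =>
        (powersetCard a (univ : Finset V)).filter fun R => S ⊆ R).card := by
        refine card_le_card fun R hR => ?_
        obtain ⟨hR, hs⟩ := mem_filter.1 hR
        obtain ⟨S, hS, hc⟩ := exists_subset_card_eq hs
        exact mem_biUnion.2 ⟨S, mem_powersetCard.2 ⟨hS.trans inter_subset_left, hc⟩,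
          mem_filter.2 ⟨hR, hS.trans inter_subset_right⟩⟩
    _ ≤ (powersetCard s X).card * (Fintype.card V - s).choose (a - s) := by
        refine card_biUnion_le_card_mul _ _ _ fun S hS => ?_
        have := card_powersetCard_filter_superset_le S a
        rwa [(mem_powersetCard.1 hS).2] at this
    _ = _ := by rw [card_powersetCard]

/-- The factor `s!` cancels between `a.choose s` and `n.choose s`; `2 * s ≤ n` gives `n ≤ 2 (n + 1 -
s)`. -/
theorem choose_mul_choose_mul_pow_le {n a s : ℕ} (hs : 2 * s ≤ n) :
    (2 * a).choose s * a.choose s * n ^ s ≤ (4 * a ^ 2) ^ s * n.choose s := by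
  have h₁ : (2 * a).choose s ≤ (2 * a) ^ s := Nat.choose_le_pow _ _
  have h₂ : s.factorial * a.choose s ≤ a ^ s := by
    rw [← Nat.descFactorial_eq_factorial_mul_choose]
    exact Nat.descFactorial_le_pow _ _
  have h₃ : (n + 1 - s) ^ s ≤ s.factorial * n.choose s := by
    rw [← Nat.descFactorial_eq_factorial_mul_choose]
    exact Nat.pow_sub_le_descFactorial _ _
  have h₄ : n ^ s ≤ 2 ^ s * (n + 1 - s) ^ s := by
    rw [← mul_pow]
    exact Nat.pow_le_pow_left (by omega) s
  calc (2 * a).choose s * a.choose s * n ^ s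
      ≤ (2 * a) ^ s * a.choose s * (2 ^ s * (s.factorial * n.choose s)) := by
        gcongr
        exact h₄.trans (by gcongr)
    _ = (2 * a) ^ s * 2 ^ s * (s.factorial * a.choose s) * n.choose s := by ring
    _ ≤ (2 * a) ^ s * 2 ^ s * a ^ s * n.choose s := by gcongr
    _ = (4 * a ^ 2) ^ s * n.choose s := by
      rw [← mul_pow, ← mul_pow]
      congr 2
      ring

/-- The left-hand side bounds the probability that a fixed set of at most `2a` elements meets a
uniformly random `a`-subset of an `n`-set in `s` or more elements. -/
theorem choose_mul_choose_div_le {n a s : ℕ} (hs : 2 * s ≤ n) (hsa : s ≤ a) (han : a ≤ n)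
    (hn : 0 < n) :
    (((2 * a).choose s * (n - s).choose (a - s) : ℕ) : ℝ) / (n.choose a : ℕ) ≤
      (4 * (a : ℝ) ^ 2 / n) ^ s := by
  have h₁ := choose_mul_choose_mul_pow_le (a := a) hs
  have h₂ := Nat.choose_mul (n := n) hsa
  have p₁ : 0 < n.choose a := Nat.choose_pos han
  have p₂ : 0 < a.choose s := Nat.choose_pos hsa
  have p₃ : 0 < n ^ s := by positivity
  have h₃ : (2 * a).choose s * (n - s).choose (a - s) * n ^ s ≤ (4 * a ^ 2) ^ s * n.choose a := by
    refine Nat.le_of_mul_le_mul_right ?_ p₂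
    calc (2 * a).choose s * (n - s).choose (a - s) * n ^ s * a.choose s
        = (2 * a).choose s * a.choose s * n ^ s * (n - s).choose (a - s) := by ring
      _ ≤ (4 * a ^ 2) ^ s * n.choose s * (n - s).choose (a - s) := by gcongr
      _ = (4 * a ^ 2) ^ s * n.choose a * a.choose s := by rw [mul_assoc, ← h₂, mul_assoc]
  rw [div_pow, div_le_div_iff₀ (by exact_mod_cast p₁) (by exact_mod_cast p₃)]
  exact_mod_cast h₃

end Counting

/-! ### Adaptive and randomized algorithms -/

section Algorithms

/-- If every query distinguishes at most `B` of the oracles `O i` from `O₀`, and every output is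
good for at most `B` of the indices `i`, then the algorithm succeeds for few indices. -/
theorem QueryAlg.card_filter_run_le {V ι : Type*} [DecidableEq ι] (O : ι → Finset V → ℝ × ℝ)
    (O₀ : Finset V → ℝ × ℝ) (F : Finset ι) (P : ι → Finset V → Prop) [∀ i S, Decidable (P i S)]
    (B : ℕ) (hO : ∀ X, (F.filter fun i => O i X ≠ O₀ X).card ≤ B)
    (hP : ∀ S, (F.filter fun i => P i S).card ≤ B) (T : QueryAlg V) :
    (F.filter fun i => P i (T.run (O i))).card ≤ (T.numQueries O₀ + 1) * B := by
  induction T with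
  | output S =>
    rw [QueryAlg.numQueries, zero_add, one_mul]
    exact hP S
  | query X next ih =>
    -- Indices that answer differently are charged to this query; all others follow the same branch
    -- `next (O₀ X)`.
    have h : (F.filter fun i => P i ((QueryAlg.query X next).run (O i))) ⊆
        (F.filter fun i => O i X ≠ O₀ X) ∪
          F.filter fun i => P i ((next (O₀ X)).run (O i)) := by
      intro i hi
      rw [mem_filter, QueryAlg.run] at hi
      rw [mem_union, mem_filter, mem_filter]
      by_cases hc : O i X = O₀ X
      · exact Or.inr ⟨hi.1, hc ▸ hi.2⟩
      · exact Or.inl ⟨hi.1, hc⟩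
    calc _ ≤ _ := card_le_card h
      _ ≤ _ := card_union_le _ _
      _ ≤ B + ((next (O₀ X)).numQueries O₀ + 1) * B := add_le_add (hO X) (ih _)
      _ = _ := by
        simp only [QueryAlg.numQueries]
        ring

-- Exchanging the averages over `i` and `T` reduces to deterministic algorithms. `I` need not be
-- injective; for `β = 0` all hidden instances coincide.
open Classical in
theorem RandAlg.avgSuccessProb_map_uniformOfFinset_le (A : RandAlg) (ρ : ℝ) {n k : ℕ} {ι : Type*}
    (F : Finset ι) (hF : F.Nonempty) (I : ι → CardInstance (Fin n)) (hk : ∀ i, (I i).k = k) (C : ℕ)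
    (hC : ∀ T ∈ (A n k).support,
      (F.filter fun i => (I i).IsApprox ρ (T.run (I i).oracle)).card ≤ C) :
    A.avgSuccessProb ρ ((PMF.uniformOfFinset F hF).map I) ≤ (F.card : ENNReal)⁻¹ * C := by
  have h₁ : A.avgSuccessProb ρ ((PMF.uniformOfFinset F hF).map I) =
      ∑' i, PMF.uniformOfFinset F hF i * A.successProb ρ (I i) := by
    simp only [RandAlg.avgSuccessProb, PMF.map_apply, ← ENNReal.tsum_mul_right]
    rw [ENNReal.tsum_comm]
    refine tsum_congr fun i => ?_
    rw [tsum_eq_single (I i) fun J hJ => by simp [hJ]]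
    simp
  have h₂ : ∀ i, A.successProb ρ (I i) =
      ∑' T, if (I i).IsApprox ρ (T.run (I i).oracle) then A n k T else 0 := fun i => by
    rw [RandAlg.successProb, hk i, PMF.toOuterMeasure_apply]
    rfl
  rw [h₁, tsum_eq_sum (s := F) fun i hi => by
    rw [PMF.uniformOfFinset_apply_of_notMem hF hi, zero_mul]]
  calc ∑ i ∈ F, PMF.uniformOfFinset F hF i * A.successProb ρ (I i)
      = (F.card : ENNReal)⁻¹ * ∑ i ∈ F, A.successProb ρ (I i) := by
        rw [mul_sum]
        exact sum_congr rfl fun i hi => by rw [PMF.uniformOfFinset_apply_of_mem hF hi]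
    _ = (F.card : ENNReal)⁻¹ * ∑' T, ∑ i ∈ F,
          if (I i).IsApprox ρ (T.run (I i).oracle) then A n k T else 0 := by
        simp only [h₂]
        rw [Summable.tsum_finsetSum fun i _ => ENNReal.summable]
    _ ≤ (F.card : ENNReal)⁻¹ * ∑' T, A n k T * C := by
        gcongr with T
        rw [← sum_filter, sum_const, nsmul_eq_mul, mul_comm]
        by_cases hT : T ∈ (A n k).support
        · gcongr
          exact hC T hT
        · simp [(PMF.apply_eq_zero_iff _ _).2 hT]
    _ = (F.card : ENNReal)⁻¹ * C := by
        rw [ENNReal.tsum_mul_right, PMF.tsum_coe, one_mul]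

end Algorithms

/-! ### Choice of parameters and decay -/

/-- The integral part of the eighth root of `n`. -/
def eighthRoot (n : ℕ) : ℕ := n.sqrt.sqrt.sqrt

theorem eighthRoot_pow_le (n : ℕ) : eighthRoot n ^ 8 ≤ n := by
  have h₁ := Nat.sqrt_le' n.sqrt.sqrt
  have h₂ := Nat.sqrt_le' n.sqrt
  have h₃ := Nat.sqrt_le' n
  calc eighthRoot n ^ 8 = ((n.sqrt.sqrt.sqrt ^ 2) ^ 2) ^ 2 := by rw [eighthRoot]; ring
    _ ≤ (n.sqrt.sqrt ^ 2) ^ 2 := by gcongr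
    _ ≤ n.sqrt ^ 2 := by gcongr
    _ ≤ n := h₃

theorem tendsto_eighthRoot : Filter.Tendsto eighthRoot Filter.atTop Filter.atTop := by
  have h : Filter.Tendsto Nat.sqrt Filter.atTop Filter.atTop :=
    Filter.tendsto_atTop_mono' _ (Filter.Eventually.of_forall fun _ => le_rfl)
      (Filter.tendsto_atTop_atTop_of_monotone (fun _ _ h => Nat.sqrt_le_sqrt h)
        fun b => ⟨b * b, by rw [Nat.sqrt_eq]⟩)
  exact h.comp (h.comp h)

theorem eighthRoot_sq_le (n : ℕ) : eighthRoot n ^ 2 ≤ n := by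
  rcases Nat.eq_zero_or_pos (eighthRoot n) with h | h
  · simp [h]
  · exact (Nat.pow_le_pow_right h (by norm_num)).trans (eighthRoot_pow_le n)

/-- The base `x` satisfies `x⁴ ≤ 1/n` once `n ≥ 256`, because `m¹⁶ ≤ n²`; so exponent `4 (K + 1)`
beats `n ^ K` with a factor `1/n` to spare. -/
theorem superpolynomialDecay_eighthRoot :
    Asymptotics.SuperpolynomialDecay Filter.atTop (fun n : ℕ => (n : ℝ)) fun n : ℕ =>
      (4 * ((eighthRoot n ^ 2 : ℕ) : ℝ) ^ 2 / n) ^ (eighthRoot n + 1) := by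
  intro K
  refine squeeze_zero' (Filter.Eventually.of_forall fun n => by positivity) ?_
    tendsto_one_div_atTop_nhds_zero_nat
  filter_upwards [Filter.eventually_ge_atTop 256,
    tendsto_eighthRoot.eventually_ge_atTop (4 * (K + 1))] with n hn hm
  have hn' : (256 : ℝ) ≤ n := by exact_mod_cast hn
  have hn₀ : (0 : ℝ) < n := by linarith
  set m := eighthRoot n
  have hm8 : (m : ℝ) ^ 8 ≤ n := by exact_mod_cast eighthRoot_pow_le n
  set x : ℝ := 4 * ((m ^ 2 : ℕ) : ℝ) ^ 2 / n with hx
  have hx₀ : 0 ≤ x := by positivity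
  have hx₄ : x ^ 4 ≤ 1 / n := by
    have e : x ^ 4 = 256 * ((m : ℝ) ^ 8) ^ 2 / n ^ 4 := by
      rw [hx, div_pow]
      push_cast
      ring
    rw [e, div_le_div_iff₀ (by positivity) hn₀]
    calc 256 * ((m : ℝ) ^ 8) ^ 2 * n ≤ n * (n : ℝ) ^ 2 * n := by gcongr
      _ = 1 * (n : ℝ) ^ 4 := by ring
  have hx₁ : x ≤ 1 := by
    by_contra! hc
    have h₁ : 1 < x ^ 4 := one_lt_pow₀ hc (by norm_num)
    have h₂ : 1 / (n : ℝ) ≤ 1 := by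
      rw [div_le_one hn₀]
      linarith
    linarith
  calc (n : ℝ) ^ K * x ^ (m + 1) ≤ (n : ℝ) ^ K * x ^ (4 * (K + 1)) := by
        gcongr ?_ * ?_
        exact pow_le_pow_of_le_one hx₀ hx₁ (by omega)
    _ ≤ (n : ℝ) ^ K * (1 / n) ^ (K + 1) := by
        rw [pow_mul]
        gcongr
    _ = 1 / n := by
        rw [div_pow, one_pow, pow_succ]
        field_simp

/-! ### The hard distribution -/

/-- The hard distribution: the hidden set is a uniformly random set of `m²` elements, of rank at
most `m`, where `m` is the eighth root of `n`. -/
noncomputable def hardDistribution (β : ℝ) (n : ℕ) : PMF (CardInstance (Fin n)) :=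
  (PMF.uniformOfFinset (powersetCard (eighthRoot n ^ 2) (univ : Finset (Fin n)))
    (powersetCard_nonempty.2 (by simpa using eighthRoot_sq_le n))).map
      (hiddenInstance β (eighthRoot n ^ 2) (eighthRoot n))

theorem hardDistribution_avgSuccessProb_le {β ε : ℝ} (hβ₀ : 0 ≤ β) (hβ₁ : β ≤ 1) (hε : 0 < ε)
    (A : RandAlg) (q : ℕ → ℕ)
    (hq : ∀ (n : ℕ) (I : CardInstance (Fin n)), I.IsBP →
      ∀ T ∈ (A n I.k).support, T.numQueries I.oracle ≤ q n) {n : ℕ} (hm : 2 ≤ eighthRoot n)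
    (hmε : (eighthRoot n : ℝ) + 1 < ε * (((eighthRoot n ^ 2 : ℕ) : ℝ) - eighthRoot n)) :
    (A.avgSuccessProb (1 - β + ε) (hardDistribution β n)).toReal ≤
      (q n + 1) * (4 * ((eighthRoot n ^ 2 : ℕ) : ℝ) ^ 2 / n) ^ (eighthRoot n + 1) := by
  classical
  have hn₁ := eighthRoot_pow_le n
  have han := eighthRoot_sq_le n
  rw [hardDistribution]
  generalize_proofs hne
  generalize eighthRoot n = m at *
  have hm₂ : m + 1 ≤ m ^ 2 := by nlinarith
  have hn₂ : 2 * (m + 1) ≤ n := by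
    have : m ^ 2 * 2 ^ 6 ≤ m ^ 8 := by
      calc m ^ 2 * 2 ^ 6 ≤ m ^ 2 * m ^ 6 := by gcongr
        _ = m ^ 8 := by ring
    omega
  have hB : ∀ (P : Finset (Fin n) → Prop) [DecidablePred P], ∀ X : Finset (Fin n),
      (∀ R : Finset (Fin n), R.card = m ^ 2 → P R →
        X.card ≤ 2 * m ^ 2 ∧ m + 1 ≤ (X ∩ R).card) →
      ((powersetCard (m ^ 2) (univ : Finset (Fin n))).filter P).card ≤
        (2 * m ^ 2).choose (m + 1) * (n - (m + 1)).choose (m ^ 2 - (m + 1)) := by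
    intro P _ X h
    by_cases hX : X.card ≤ 2 * m ^ 2
    · refine (card_le_card (t := (powersetCard (m ^ 2) (univ : Finset (Fin n))).filter
        fun R => m + 1 ≤ (X ∩ R).card) ?_).trans
          ((card_powersetCard_filter_le_card_inter_le _ _ X).trans ?_)
      · intro R hR
        obtain ⟨hR, hP⟩ := mem_filter.1 hR
        exact mem_filter.2 ⟨hR, (h R (mem_powersetCard.1 hR).2 hP).2⟩
      · rw [Fintype.card_fin]
        gcongr
    · rw [filter_false_of_mem fun R hR hP => hX (h R (mem_powersetCard.1 hR).2 hP).1]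
      simp
  have hbound := A.avgSuccessProb_map_uniformOfFinset_le (1 - β + ε)
    (powersetCard (m ^ 2) (univ : Finset (Fin n))) hne
    (hiddenInstance β (m ^ 2) m) (fun _ => rfl)
    ((q n + 1) * ((2 * m ^ 2).choose (m + 1) * (n - (m + 1)).choose (m ^ 2 - (m + 1))))
    fun T hT => (QueryAlg.card_filter_run_le
      (fun R : Finset (Fin n) => (hiddenInstance β (m ^ 2) m R).oracle)
      (hiddenInstance β (m ^ 2) m ∅).oracle _
      (fun R => (hiddenInstance β (m ^ 2) m R).IsApprox (1 - β + ε)) _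
      (fun X => hB _ X fun R hR => of_oracle_hiddenInstance_ne hR)
      (fun S => hB _ S fun R hR => of_isApprox_hiddenInstance hβ₀ hβ₁ hε hR (by omega) hmε)
      T).trans
        -- The query bound is needed only on the `∅` instance, which is BP with the same `k`
        -- although it is not in the support.
        (Nat.mul_le_mul_right _ (Nat.succ_le_succ
          (hq n _ (hiddenInstance_isBP hβ₀ hβ₁ (m ^ 2) m ∅) T hT)))
  have hpos : 0 < n.choose (m ^ 2) := Nat.choose_pos han
  rw [card_powersetCard, card_univ, Fintype.card_fin] at hbound
  refine (ENNReal.toReal_mono ?_ hbound).trans ?_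
  · exact ENNReal.mul_ne_top (by simpa using hpos.ne') (ENNReal.natCast_ne_top _)
  · have h := choose_mul_choose_div_le hn₂ hm₂ han (by omega)
    rw [ENNReal.toReal_mul, ENNReal.toReal_inv, ENNReal.toReal_natCast, ENNReal.toReal_natCast,
      Nat.cast_mul, inv_mul_eq_div, mul_div_assoc]
    push_cast at h ⊢
    gcongr

end BPMax

open BPMax

theorem mainTheorem5 (β : ℝ) (hβ₀ : 0 ≤ β) (hβ₁ : β ≤ 1) :
    ∃ D : (n : ℕ) → PMF (BPMax.CardInstance (Fin n)),
      (∀ᶠ n in Filter.atTop, ∀ I ∈ (D n).support,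
        I.IsBP ∧ (∀ v : Fin n, 0 < BPMax.gain I.g v (Finset.univ.erase v)) ∧
          BPMax.supermodularCurvature I.g = β) ∧
      ∀ A : BPMax.RandAlg, A.PolyQueries → ∀ ε : ℝ, 0 < ε →
        Asymptotics.SuperpolynomialDecay Filter.atTop (fun n : ℕ => (n : ℝ))
          fun n : ℕ => (A.avgSuccessProb (1 - β + ε) (D n)).toReal := by
  refine ⟨hardDistribution β, ?_, ?_⟩
  · filter_upwards [tendsto_eighthRoot.eventually_ge_atTop 2] with n hm I hI
    obtain ⟨R, hR, rfl⟩ := (PMF.mem_support_map_iff _ _ _).1 hI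
    rw [PMF.mem_support_uniformOfFinset_iff, Finset.mem_powersetCard] at hR
    have hn := eighthRoot_pow_le n
    generalize eighthRoot n = m at *
    have hn₂ : m ^ 2 * 2 ^ 6 ≤ m ^ 8 := by
      calc m ^ 2 * 2 ^ 6 ≤ m ^ 2 * m ^ 6 := by gcongr
        _ = m ^ 8 := by ring
    have hm₂ : 1 ≤ m ^ 2 := Nat.one_le_pow _ _ (by omega)
    have : Nonempty (Fin n) := ⟨⟨0, by omega⟩⟩
    have h₁ : 2 * m ^ 2 ≤ Fintype.card (Fin n) := by rw [Fintype.card_fin]; omega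
    have h₂ : m ^ 2 + 1 ≤ Fintype.card (Fin n) := by rw [Fintype.card_fin]; omega
    refine ⟨hiddenInstance_isBP hβ₀ hβ₁ _ _ R, fun v => ?_, ?_⟩
    · rw [gain_hiddenInstance_univ_erase β hR.2 (by omega) h₁ h₂]
      exact one_pos
    · exact supermodularCurvature_hiddenInstance β hR.2 hm₂ (by omega) h₁ h₂
  · rintro A ⟨p, hp⟩ ε hε
    have hdecay := superpolynomialDecay_eighthRoot.polynomial_mul (p.map (Nat.castRingHom ℝ) + 1)
    refine hdecay.trans_eventually_abs_le ?_
    -- For `m ≥ N + 1` this gives `ε (m - 1) > 2`, hence `ε (m² - m) > 2m ≥ m + 1`.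
    obtain ⟨N, hN⟩ := exists_nat_gt (2 / ε)
    filter_upwards [tendsto_eighthRoot.eventually_ge_atTop 2,
      tendsto_eighthRoot.eventually_ge_atTop (N + 1)] with n hm hmN
    have hmε : (eighthRoot n : ℝ) + 1 < ε * (((eighthRoot n ^ 2 : ℕ) : ℝ) - eighthRoot n) := by
      have h₁ : (2 : ℝ) ≤ eighthRoot n := by exact_mod_cast hm
      have h₂ : (N : ℝ) + 1 ≤ eighthRoot n := by exact_mod_cast hmN
      have h₃ : 2 < ε * (eighthRoot n - 1) := by
        rw [div_lt_iff₀ hε] at hN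
        nlinarith
      push_cast
      nlinarith
    have h := hardDistribution_avgSuccessProb_le hβ₀ hβ₁ hε A (fun n => p.eval n) hp hm hmε
    have he : (p.map (Nat.castRingHom ℝ) + 1).eval (n : ℝ) = (p.eval n : ℕ) + 1 := by
      simp [Polynomial.eval_natCast_map]
    rw [Function.comp_apply, Function.comp_apply, abs_of_nonneg ENNReal.toReal_nonneg]
    refine le_trans ?_ (le_abs_self _)
    simpa only [he] using h
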